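/- Let $k$ be an algebraically closed field of arbitrary characteristic and let $S=k[x,y,z,w]$ be the homogeneous coordinate ring of $\mathbf P^3=\mathbf P^3_k$. A \emph{pseudo-star configuration} of lines in $\mathbf P^3$ is a finite collection of lines of the following form: there is a finite set $\{H_1,\dots,H_d\}$ of (pairwise distinct) planes in $\mathbf P^3$, no three of which contain a common line, and the collection consists of the lines $\ell_{ij}=H_i\cap H_j$, $1\le i<j\le d$. For an ideal $I\subseteq S$ and $m\ge 1$, the $m$-th symbolic power of $I$ is $$I^{(m)}=S\cap\bigcap_{P\in\operatorname{Ass}(I)} I^mS_P ,$$ where $\operatorname{Ass}(I)$ is the set of associated primes of $S/I$. \textbf{Proposition.} Let $\mathbb L=\bigcup_{i<j}\ell_{ij}$ be the union of the lines of a pseudo-star configuration in $\mathbf P^3$, and let $I=I(\mathbb L)\subseteq S$ be the homogeneous ideal generated by all forms vanishing on $\mathbb L$. Then $\mathbb L$ and its symbolic square $2\mathbb L$ (the subscheme defined by $I^{(2)}$) are arithmetically Cohen--Macaulay, i.e. the homogeneous coordinate rings $S/I$ and $S/I^{(2)}$ are Cohen--Macaulay rings. (If $d\le 1$ there are no lines,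 both rings are zero, and the zero ring counts as Cohen--Macaulay.) -/

import Mathlib

open scoped LinearAlgebra.Projectivization

/-! ### Cohen–Macaulay rings -/

/-- The depth of a local ring: the supremum of the lengths of the regular sequences contained in
the maximal ideal. -/
noncomputable def localDepth (R : Type*) [CommRing R] [IsLocalRing R] : ℕ∞ :=
  ⨆ (rs : List R) (_ : (∀ r ∈ rs, r ∈ IsLocalRing.maximalIdeal R) ∧
    RingTheory.Sequence.IsRegular R rs), (rs.length : ℕ∞)

/-- A local ring is Cohen–Macaulay if it is Noetherian and its depth equals its Krull dimension. -/
structure IsCohenMacaulayLocal (R : Type*) [CommRing R] [IsLocalRing R] : Prop where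
  noetherian : IsNoetherianRing R
  depth_eq_dim : (localDepth R : WithBot ℕ∞) = ringKrullDim R

/-- A commutative ring is Cohen–Macaulay if it is Noetherian and all its localizations at maximal
ideals are Cohen–Macaulay local rings. (The zero ring is thus Cohen–Macaulay.) -/
structure IsCohenMacaulay (R : Type*) [CommRing R] : Prop where
  noetherian : IsNoetherianRing R
  localization : ∀ (m : Ideal R) [m.IsMaximal], IsCohenMacaulayLocal (Localization.AtPrime m)

/-! ### Symbolic powers -/

/-- The `m`-th symbolic power `R ∩ ⋂_{P ∈ Ass(I)} I^m R_P` of an ideal `I` of `R`, where `Ass(I)` is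
the set of associated primes of `R ⧸ I`. -/
noncomputable def symbolicPower {R : Type*} [CommRing R] (I : Ideal R) (m : ℕ) : Ideal R :=
  ⨅ P : {P : Ideal R // P ∈ associatedPrimes R (R ⧸ I)},
    haveI : P.1.IsPrime := P.2.isPrime
    ((I ^ m).map (algebraMap R (Localization.AtPrime P.1))).comap
      (algebraMap R (Localization.AtPrime P.1))

/-! ### Lines and planes in projective 3-space -/

section

variable {k : Type*} [Field k]

/-- The homogeneous ideal `I(X)` in `k[x₀, …, x_N]` of a set `X` of points of `ℙ^N`: it is generated
by the homogeneous polynomials that vanish at every point of `X`. -/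
noncomputable def homogeneousIdealOf {N : ℕ} (X : Set (ℙ k (Fin (N + 1) → k))) :
    Ideal (MvPolynomial (Fin (N + 1)) k) :=
  Ideal.span {f | (∃ n : ℕ, f.IsHomogeneous n) ∧ ∀ P ∈ X, MvPolynomial.eval P.rep f = 0}

/-- The subscheme of `ℙ^N` whose (saturated) homogeneous ideal is `J` is arithmetically
Cohen–Macaulay: its homogeneous coordinate ring `k[x₀, …, x_N] ⧸ J` is Cohen–Macaulay. -/
def IsACM {N : ℕ} (J : Ideal (MvPolynomial (Fin (N + 1)) k)) : Prop :=
  IsCohenMacaulay (MvPolynomial (Fin (N + 1)) k ⧸ J)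

/-- A line in `ℙ³`: a linear subspace of projective dimension 1. -/
def IsLine (L : Projectivization.Subspace k (Fin 4 → k)) : Prop :=
  Module.finrank k (Projectivization.Subspace.submodule L) = 2

/-- A plane (hyperplane) in `ℙ³`: a linear subspace of projective dimension 2. -/
def IsPlane (H : Projectivization.Subspace k (Fin 4 → k)) : Prop :=
  Module.finrank k (Projectivization.Subspace.submodule H) = 3

/-- A set `𝓛` of lines in `ℙ³` is a pseudo-star configuration if it consists of the pairwise
intersections of the members of a finite set `𝓗` of planes, no three of which contain a line. -/
def IsPseudostar (𝓛 : Set (Projectivization.Subspace k (Fin 4 → k))) : Prop :=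
  ∃ 𝓗 : Set (Projectivization.Subspace k (Fin 4 → k)),
    𝓗.Finite ∧ (∀ H ∈ 𝓗, IsPlane H) ∧
    (∀ H₁ ∈ 𝓗, ∀ H₂ ∈ 𝓗, ∀ H₃ ∈ 𝓗, H₁ ≠ H₂ → H₁ ≠ H₃ → H₂ ≠ H₃ →
      ¬ ∃ L, IsLine L ∧ L ≤ H₁ ∧ L ≤ H₂ ∧ L ≤ H₃) ∧
    𝓛 = {L | ∃ H₁ ∈ 𝓗, ∃ H₂ ∈ 𝓗, H₁ ≠ H₂ ∧ L = H₁ ⊓ H₂}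

/-- The set of points of `ℙ³` lying on some member of `𝓛`. -/
def unionOf (𝓛 : Set (Projectivization.Subspace k (Fin 4 → k))) : Set (ℙ k (Fin 4 → k)) :=
  ⋃ L ∈ 𝓛, (L : Set (ℙ k (Fin 4 → k)))

end

/-! Write `L a` for a linear form cutting out the plane `a`, and `I_m(s)` for the intersection of
the ideals `(L a, L b) ^ m` over distinct `a, b ∈ s`. The ideal of the line configuration is
`I_1(s)` (`homogeneousIdealOf_eq_pairIdeal`) and its symbolic square is `I_2(s)`
(`PairwisePrime.symbolicPower_two`).

The planes are added one at a time. Let `i` be the new plane, `t = insert i s`, `F = ∏ a ∈ s, L a`.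
Then `I_1(t) : L i = I_1(s)` and `I_1(t) + (L i) = (L i, F)`. For squares, two colons are needed:
with `M = I_2(s) ∩ ⋂ (L i, L a)`, one has `I_2(t) : L i = M` and `M : L i = I_2(s)`, while the sums
with `(L i)` are `(L i, F ^ 2)` and `(L i, F)`. These last ideals also split into the ideals `(L i,
L a)` by colons. So every ideal involved is assembled from ideals of single lines through sequences
`0 → R/(J : h) → R/J → R/(J + (h)) → 0`.

It remains to find a property that holds for single lines, passes through such extensions and
implies Cohen–Macaulayness. That is `HasRegularParameters`, for two generic linear forms `u, v` that
serve all lines at once: the quotient is integral over `k[u, v]`, and `u - a, v - b` is weakly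
regular for all scalars. Over an algebraically closed field each maximal ideal contains such a pair,
so each local ring has a regular sequence of length 2, while integrality bounds its dimension by 2.
Weak regularity admits the zero quotient, which starts the inductions. -/

/-! ### Colon ideals and sums for intersections of powers of `(L a, L b)` -/

section PairIdeal

variable {R ι : Type*} [CommRing R]

/-- The intersection of the `m`-th powers of the ideals `(L a, L b)` for distinct `a, b ∈ s`. -/
def pairIdeal (L : ι → R) (s : Finset ι) (m : ℕ) : Ideal R :=
  ⨅ a ∈ s, ⨅ b ∈ s, ⨅ _ : a ≠ b, Ideal.span {L a, L b} ^ m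

theorem mem_pairIdeal {L : ι → R} {s : Finset ι} {m : ℕ} {x : R} :
    x ∈ pairIdeal L s m ↔ ∀ a ∈ s, ∀ b ∈ s, a ≠ b → x ∈ Ideal.span {L a, L b} ^ m := by
  simp [pairIdeal, Submodule.mem_iInf]

theorem mem_span_pair_sq {a b x : R} :
    x ∈ Ideal.span {a, b} ^ 2 ↔ ∃ p q r, x = p * a ^ 2 + q * (a * b) + r * b ^ 2 := by
  rw [pow_two, Ideal.span_pair_mul_span_pair]
  constructor
  · intro h
    simp only [Ideal.mem_span_insert, Ideal.mem_span_singleton'] at h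
    obtain ⟨p, y, ⟨q, z, ⟨r, w, ⟨t, rfl⟩, rfl⟩, rfl⟩, rfl⟩ := h
    exact ⟨p, q + r, t, by ring⟩
  · rintro ⟨p, q, r, rfl⟩
    refine add_mem (add_mem ?_ ?_) ?_ <;> refine Ideal.mul_mem_left _ _ (Ideal.subset_span ?_) <;>
      simp [pow_two]

theorem left_mem_span_pair (a b : R) : a ∈ Ideal.span {a, b} := Ideal.subset_span (by simp)

theorem right_mem_span_pair (a b : R) : b ∈ Ideal.span {a, b} := Ideal.subset_span (by simp)

/-- Linear-form-like elements `L a`, `a ∈ s`, of a ring whose pairs generate prime ideals, no three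
of which meet in codimension two. -/
structure PairwisePrime (L : ι → R) (s : Finset ι) : Prop where
  prime_single : ∀ a ∈ s, ∀ b ∈ s, a ≠ b → (Ideal.span {L a}).IsPrime
  notMem_single : ∀ a ∈ s, ∀ b ∈ s, a ≠ b → L b ∉ Ideal.span {L a}
  prime_pair : ∀ a ∈ s, ∀ b ∈ s, a ≠ b → (Ideal.span {L a, L b}).IsPrime
  notMem_pair : ∀ a ∈ s, ∀ b ∈ s, ∀ c ∈ s, a ≠ b → a ≠ c → b ≠ c → L c ∉ Ideal.span {L a, L b}

theorem PairwisePrime.mono {L : ι → R} {s t : Finset ι} (h : PairwisePrime L t) (hst : s ⊆ t) :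
    PairwisePrime L s :=
  ⟨fun a ha b hb => h.1 a (hst ha) b (hst hb), fun a ha b hb => h.2 a (hst ha) b (hst hb),
    fun a ha b hb => h.3 a (hst ha) b (hst hb),
    fun a ha b hb c hc => h.4 a (hst ha) b (hst hb) c (hst hc)⟩

/-- If `(a, b)` and `(a)` are prime and `b ∉ (a)`, then `(a, b) ^ 2` is `(a, b)`-primary. -/
theorem mem_span_pair_sq_of_mul_mem {a b s f : R} (ha : (Ideal.span {a}).IsPrime)
    (hb : b ∉ Ideal.span {a}) (hab : (Ideal.span {a, b}).IsPrime) (hs : s ∉ Ideal.span {a, b})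
    (h : s * f ∈ Ideal.span {a, b} ^ 2) [IsDomain R] (ha0 : a ≠ 0) :
    f ∈ Ideal.span {a, b} ^ 2 := by
  have hf : f ∈ Ideal.span {a, b} :=
    (hab.mem_or_mem (Ideal.pow_le_self two_ne_zero h)).resolve_left hs
  obtain ⟨α, β, rfl⟩ := Ideal.mem_span_pair.1 hf
  obtain ⟨p, q, r, hpqr⟩ := mem_span_pair_sq.1 h
  -- Compare both expressions for `s * (α * a + β * b)` modulo `a` and cancel `b`.
  have h1 : s * β - r * b ∈ Ideal.span {a} := by
    refine (ha.mem_or_mem (y := b) ?_).resolve_right hb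
    exact Ideal.mem_span_singleton'.2 ⟨p * a + q * b - s * α, by linear_combination -hpqr⟩
  obtain ⟨t, ht⟩ := Ideal.mem_span_singleton'.1 h1
  have hβ : β ∈ Ideal.span {a, b} := by
    refine (hab.mem_or_mem (x := s) ?_).resolve_left hs
    exact Ideal.mem_span_pair.2 ⟨t, r, by linear_combination ht⟩
  have hα : α ∈ Ideal.span {a, b} := by
    refine (hab.mem_or_mem (x := s) ?_).resolve_left hs
    -- Substituting `s * β = t * a + r * b` leaves a relation divisible by `a`.
    refine Ideal.mem_span_pair.2 ⟨p, q - t, mul_left_cancel₀ ha0 ?_⟩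
    linear_combination -hpqr - b * ht
  rw [pow_two]
  exact add_mem (Ideal.mul_mem_mul hα (left_mem_span_pair a b))
    (Ideal.mul_mem_mul hβ (right_mem_span_pair a b))

/-- The colon ideal `(a, b) ^ 2 : a` is `(a, b)`. -/
theorem mul_mem_span_pair_sq_iff {a b x : R} [IsDomain R] (ha : (Ideal.span {a}).IsPrime)
    (hb : b ∉ Ideal.span {a}) (ha0 : a ≠ 0) :
    a * x ∈ Ideal.span {a, b} ^ 2 ↔ x ∈ Ideal.span {a, b} := by
  refine ⟨fun h => ?_, fun h => ?_⟩
  · obtain ⟨p, q, r, hpqr⟩ := mem_span_pair_sq.1 h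
    have h1 : r * b ^ 2 ∈ Ideal.span {a} :=
      Ideal.mem_span_singleton'.2 ⟨x - p * a - q * b, by linear_combination hpqr⟩
    have h2 := (ha.mem_or_mem h1).resolve_right fun h => hb (ha.mem_of_pow_mem _ h)
    obtain ⟨t, rfl⟩ := Ideal.mem_span_singleton'.1 h2
    refine Ideal.mem_span_pair.2 ⟨p, q + t * b, mul_left_cancel₀ ha0 ?_⟩
    linear_combination -hpqr
  · rw [pow_two]
    exact Ideal.mul_mem_mul (left_mem_span_pair a b) h

/-- `⋂ (l, L a) ⊆ (l, ∏ L a)` for pairwise coprime primes `(l, L a)`. -/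
theorem mem_span_pair_prod {L : ι → R} {s : Finset ι} {l x : R}
    (hp : ∀ a ∈ s, (Ideal.span {l, L a}).IsPrime)
    (hn : ∀ a ∈ s, ∀ b ∈ s, a ≠ b → L b ∉ Ideal.span {l, L a})
    (hx : ∀ a ∈ s, x ∈ Ideal.span {l, L a}) : x ∈ Ideal.span {l, ∏ a ∈ s, L a} := by
  classical
  induction s using Finset.induction_on with
  | empty => simp [Ideal.span_insert]
  | insert i s hi ih =>
    have h1 := ih (fun a ha => hp a (by simp [ha]))
      (fun a ha b hb => hn a (by simp [ha]) b (by simp [hb])) (fun a ha => hx a (by simp [ha]))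
    obtain ⟨α, β, rfl⟩ := Ideal.mem_span_pair.1 h1
    have hpi := hp i (by simp)
    have h2 : β * ∏ a ∈ s, L a ∈ Ideal.span {l, L i} := by
      have := sub_mem (hx i (by simp)) (Ideal.mul_mem_left _ α (left_mem_span_pair l (L i)))
      simpa using this
    have h3 : β ∈ Ideal.span {l, L i} := by
      refine (hpi.mem_or_mem h2).resolve_right fun h => ?_
      obtain ⟨b, hb, hb'⟩ := hpi.prod_mem_iff.1 h
      exact hn i (by simp) b (by simp [hb]) (by rintro rfl; exact hi hb) hb'
    obtain ⟨γ, δ, rfl⟩ := Ideal.mem_span_pair.1 h3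
    rw [Finset.prod_insert hi]
    exact Ideal.mem_span_pair.2 ⟨α + γ * ∏ a ∈ s, L a, δ, by ring⟩

/-- `⋂ (l, L a ^ 2) ⊆ (l, (∏ L a) ^ 2)` for pairwise coprime primes `(l, L a)`. -/
theorem mem_span_pair_prod_sq {L : ι → R} {s : Finset ι} {l x : R} (hl : (Ideal.span {l}).IsPrime)
    (hls : ∀ a ∈ s, L a ∉ Ideal.span {l})
    (hp : ∀ a ∈ s, (Ideal.span {l, L a}).IsPrime)
    (hn : ∀ a ∈ s, ∀ b ∈ s, a ≠ b → L b ∉ Ideal.span {l, L a})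
    (hx : ∀ a ∈ s, x ∈ Ideal.span {l, L a ^ 2}) : x ∈ Ideal.span {l, (∏ a ∈ s, L a) ^ 2} := by
  classical
  have h1 : x ∈ Ideal.span {l, ∏ a ∈ s, L a} := by
    refine mem_span_pair_prod hp hn fun a ha => ?_
    obtain ⟨p, q, rfl⟩ := Ideal.mem_span_pair.1 (hx a ha)
    exact Ideal.mem_span_pair.2 ⟨p, q * L a, by ring⟩
  obtain ⟨α, β, rfl⟩ := Ideal.mem_span_pair.1 h1
  have h2 : β ∈ Ideal.span {l, ∏ a ∈ s, L a} := by
    refine mem_span_pair_prod hp hn fun a ha => ?_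
    obtain ⟨p, q, hpq⟩ := Ideal.mem_span_pair.1 (hx a ha)
    rw [← Finset.mul_prod_erase s L ha] at hpq
    -- Modulo the prime `(l)`, one factor `L a` cancels from both sides.
    have h3 : β * (∏ b ∈ s.erase a, L b) - q * L a ∈ Ideal.span {l} := by
      refine (hl.mem_or_mem (y := L a) ?_).resolve_right (hls a ha)
      exact Ideal.mem_span_singleton'.2 ⟨p - α, by linear_combination hpq⟩
    obtain ⟨t, ht⟩ := Ideal.mem_span_singleton'.1 h3
    refine ((hp a ha).mem_or_mem (y := ∏ b ∈ s.erase a, L b) ?_).resolve_right fun h => ?_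
    · exact Ideal.mem_span_pair.2 ⟨t, q, by linear_combination ht⟩
    · obtain ⟨b, hb, hb'⟩ := (hp a ha).prod_mem_iff.1 h
      exact hn a ha b (Finset.mem_of_mem_erase hb) (Finset.ne_of_mem_erase hb).symm hb'
  obtain ⟨γ, δ, rfl⟩ := Ideal.mem_span_pair.1 h2
  exact Ideal.mem_span_pair.2 ⟨α + γ * ∏ a ∈ s, L a, δ, by ring⟩

/-- A property of ideals is closed under extensions if it holds for `J` whenever it holds for the
colon ideal `J : h` and the sum `J + (h)`, the outer terms of
`0 → R ⧸ (J : h) → R ⧸ J → R ⧸ (J + (h)) → 0`. -/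
def ExtensionClosed (P : Ideal R → Prop) : Prop :=
  ∀ (J K : Ideal R) (h : R), (∀ x, h * x ∈ J ↔ x ∈ K) → P K → P (J ⊔ Ideal.span {h}) → P J

variable {P : Ideal R → Prop}

/-- Since `h` is a nonzerodivisor modulo `l`, `(l, g * h) : h = (l, g)`; and `(l, g * h) + (h) = (l,
h)`. -/
theorem ExtensionClosed.span_pair_mul (hP : ExtensionClosed P) {l g h : R}
    (hl : (Ideal.span {l}).IsPrime) (hh : h ∉ Ideal.span {l}) (hg : P (Ideal.span {l, g}))
    (hh' : P (Ideal.span {l, h})) : P (Ideal.span {l, g * h}) := by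
  refine hP _ (Ideal.span {l, g}) h (fun x => ⟨fun hx => ?_, fun hx => ?_⟩) hg ?_
  · obtain ⟨p, q, hpq⟩ := Ideal.mem_span_pair.1 hx
    have h1 : x - q * g ∈ Ideal.span {l} := by
      refine (hl.mem_or_mem (x := h) ?_).resolve_left hh
      exact Ideal.mem_span_singleton'.2 ⟨p, by linear_combination hpq⟩
    obtain ⟨t, ht⟩ := Ideal.mem_span_singleton'.1 h1
    exact Ideal.mem_span_pair.2 ⟨t, q, by linear_combination ht⟩
  · obtain ⟨p, q, rfl⟩ := Ideal.mem_span_pair.1 hx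
    exact Ideal.mem_span_pair.2 ⟨h * p, q, by ring⟩
  · convert hh' using 1
    apply le_antisymm
    · refine sup_le (Ideal.span_le.2 ?_) (Ideal.span_le.2 ?_)
      · rintro x (rfl | rfl)
        · exact left_mem_span_pair _ _
        · exact Ideal.mul_mem_left _ _ (right_mem_span_pair _ _)
      · rintro x rfl
        exact right_mem_span_pair _ _
    · refine Ideal.span_le.2 ?_
      rintro x (rfl | rfl)
      · exact Ideal.mem_sup_left (left_mem_span_pair _ _)
      · exact Ideal.mem_sup_right (Ideal.mem_span_singleton_self _)

theorem ExtensionClosed.span_pair_prod (hP : ExtensionClosed P) (htop : P ⊤) {L : ι → R}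
    {s : Finset ι} {l : R} (hl : ∀ a ∈ s, (Ideal.span {l}).IsPrime)
    (hls : ∀ a ∈ s, L a ∉ Ideal.span {l})
    (hp : ∀ a ∈ s, P (Ideal.span {l, L a})) : P (Ideal.span {l, ∏ a ∈ s, L a}) := by
  classical
  induction s using Finset.induction_on with
  | empty => simpa [Ideal.span_insert] using htop
  | insert i s hi ih =>
    rw [Finset.prod_insert hi, mul_comm]
    exact hP.span_pair_mul (hl i (by simp)) (hls i (by simp))
      (ih (fun a ha => hl a (by simp [ha])) (fun a ha => hls a (by simp [ha]))
        (fun a ha => hp a (by simp [ha]))) (hp i (by simp))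

theorem ExtensionClosed.span_pair_prod_sq (hP : ExtensionClosed P) (htop : P ⊤) {L : ι → R}
    {s : Finset ι} {l : R} (hl : ∀ a ∈ s, (Ideal.span {l}).IsPrime)
    (hls : ∀ a ∈ s, L a ∉ Ideal.span {l})
    (hp : ∀ a ∈ s, P (Ideal.span {l, L a})) : P (Ideal.span {l, (∏ a ∈ s, L a) ^ 2}) := by
  have h1 := hP.span_pair_prod htop hl hls hp
  obtain rfl | ⟨a, ha⟩ := s.eq_empty_or_nonempty
  · simpa [Ideal.span_insert] using htop
  · rw [pow_two]
    refine hP.span_pair_mul (hl a ha) (fun h => ?_) h1 h1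
    obtain ⟨b, hb, hb'⟩ := (hl a ha).prod_mem_iff.1 h
    exact hls b hb hb'

section

variable {L : ι → R} {s : Finset ι} {i : ι}

theorem prod_mem_span_pair {a : ι} (ha : a ∈ s) (l : R) :
    ∏ b ∈ s, L b ∈ Ideal.span {l, L a} :=
  Ideal.mem_of_dvd _ (Finset.dvd_prod_of_mem L ha) (right_mem_span_pair _ _)

theorem prod_mem_span_pair_sq {a b : ι} (ha : a ∈ s) (hb : b ∈ s) (hab : a ≠ b) :
    ∏ c ∈ s, L c ∈ Ideal.span {L a, L b} ^ 2 := by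
  classical
  rw [← Finset.mul_prod_erase s L ha, pow_two]
  exact Ideal.mul_mem_mul (left_mem_span_pair _ _)
    (prod_mem_span_pair (by simp [hb, hab.symm]) _)

/-- The pair ideal is determined by the pairs within `s` and the pairs `(i, a)` with `a ∈ s`. -/
theorem mem_pairIdeal_insert [DecidableEq ι] (hi : i ∉ s) {m : ℕ} {x : R} :
    x ∈ pairIdeal L (insert i s) m ↔
      x ∈ pairIdeal L s m ∧ ∀ a ∈ s, x ∈ Ideal.span {L i, L a} ^ m := by
  simp only [mem_pairIdeal]
  constructor
  · intro h
    exact ⟨fun a ha b hb => h a (by simp [ha]) b (by simp [hb]),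
      fun a ha => h i (by simp) a (by simp [ha]) (by rintro rfl; exact hi ha)⟩
  · rintro ⟨h1, h2⟩ a ha b hb hab
    rcases Finset.mem_insert.1 ha with rfl | ha <;> rcases Finset.mem_insert.1 hb with rfl | hb
    · exact absurd rfl hab
    · exact h2 b hb
    · rw [Set.pair_comm]
      exact h2 a (by assumption)
    · exact h1 a ha b hb hab

theorem PairwisePrime.ne_zero (h : PairwisePrime L s) {a b : ι} (ha : a ∈ s) (hb : b ∈ s)
    (hab : a ≠ b) : L a ≠ 0 := fun h0 =>
  h.notMem_single b hb a ha hab.symm (h0 ▸ zero_mem _)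

/-- The ideal `⋂ (L a, L b) ^ 2 ∩ ⋂ (L i, L a)`, where `a, b` run through `s`. -/
def mixedPairIdeal (L : ι → R) (s : Finset ι) (i : ι) : Ideal R :=
  pairIdeal L s 2 ⊓ ⨅ a ∈ s, Ideal.span {L i, L a}

theorem mem_mixedPairIdeal {x : R} : x ∈ mixedPairIdeal L s i ↔
    x ∈ pairIdeal L s 2 ∧ ∀ a ∈ s, x ∈ Ideal.span {L i, L a} := by
  simp [mixedPairIdeal, Submodule.mem_iInf]

theorem sup_eq_span_pair {J : Ideal R} {l f : R} (hf : f ∈ J)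
    (hJ : ∀ x ∈ J, x ∈ Ideal.span {l, f}) : J ⊔ Ideal.span {l} = Ideal.span {l, f} := by
  apply le_antisymm
  · refine sup_le hJ (Ideal.span_mono (by simp))
  · refine Ideal.span_le.2 ?_
    rintro x (rfl | rfl)
    · exact Ideal.mem_sup_right (Ideal.mem_span_singleton_self _)
    · exact Ideal.mem_sup_left hf

theorem ExtensionClosed.pairIdeal_one (hP : ExtensionClosed P) (htop : P ⊤)
    (hL : PairwisePrime L s)
    (hp : ∀ a ∈ s, ∀ b ∈ s, a ≠ b → P (Ideal.span {L a, L b})) : P (pairIdeal L s 1) := by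
  classical
  induction s using Finset.induction_on with
  | empty => simpa [pairIdeal] using htop
  | insert i s hi ih =>
    have hne : ∀ a ∈ s, i ≠ a := by rintro a ha rfl; exact hi ha
    have hmem : i ∈ insert i s := by simp
    have hsub : ∀ a ∈ s, a ∈ insert i s := fun a ha => by simp [ha]
    -- `L i` lies in every new prime `(L i, L a)` and outside every old one, so the colon by `L i`
    -- removes exactly the new lines.
    refine hP _ (pairIdeal L s 1) (L i) (fun x => ?_)
      (ih (hL.mono (Finset.subset_insert _ _)) fun a ha b hb => hp a (hsub a ha) b (hsub b hb)) ?_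
    · rw [mem_pairIdeal_insert hi]
      simp only [mem_pairIdeal, pow_one]
      constructor
      · rintro ⟨h, -⟩ a ha b hb hab
        exact ((hL.prime_pair a (hsub a ha) b (hsub b hb) hab).mem_or_mem
          (h a ha b hb hab)).resolve_left
          (hL.notMem_pair a (hsub a ha) b (hsub b hb) i hmem hab (hne a ha).symm (hne b hb).symm)
      · intro h
        exact ⟨fun a ha b hb hab => Ideal.mul_mem_left _ _ (h a ha b hb hab),
          fun a ha => Ideal.mul_mem_right _ _ (left_mem_span_pair _ _)⟩
    · rw [sup_eq_span_pair (f := ∏ a ∈ s, L a)]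
      · exact hP.span_pair_prod htop
          (fun a ha => hL.prime_single i hmem a (hsub a ha) (hne a ha))
          (fun a ha => hL.notMem_single i hmem a (hsub a ha) (hne a ha))
          (fun a ha => hp i hmem a (hsub a ha) (hne a ha))
      · rw [mem_pairIdeal_insert hi]
        simp only [mem_pairIdeal, pow_one]
        exact ⟨fun a ha b hb hab => prod_mem_span_pair hb _, fun a ha => prod_mem_span_pair ha _⟩
      · intro x hx
        rw [mem_pairIdeal_insert hi] at hx
        refine mem_span_pair_prod (fun a ha => hL.prime_pair i hmem a (hsub a ha) (hne a ha))
          (fun a ha b hb hab => hL.notMem_pair i hmem a (hsub a ha) b (hsub b hb) (hne a ha)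
            (hne b hb) hab) (by simpa using hx.2)

theorem ExtensionClosed.pairIdeal_two [IsDomain R] (hP : ExtensionClosed P) (htop : P ⊤)
    (hL : PairwisePrime L s)
    (hp : ∀ a ∈ s, ∀ b ∈ s, a ≠ b → P (Ideal.span {L a, L b})) : P (pairIdeal L s 2) := by
  classical
  induction s using Finset.induction_on with
  | empty => simpa [pairIdeal] using htop
  | insert i s hi ih =>
    have hne : ∀ a ∈ s, i ≠ a := by rintro a ha rfl; exact hi ha
    have hmem : i ∈ insert i s := by simp
    have hsub : ∀ a ∈ s, a ∈ insert i s := fun a ha => by simp [ha]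
    have hi0 : ∀ a ∈ s, L i ≠ 0 := fun a ha => hL.ne_zero hmem (hsub a ha) (hne a ha)
    have hs1 : ∀ a ∈ s, (Ideal.span {L i}).IsPrime := fun a ha =>
      hL.prime_single i hmem a (hsub a ha) (hne a ha)
    have hn1 : ∀ a ∈ s, L a ∉ Ideal.span {L i} := fun a ha =>
      hL.notMem_single i hmem a (hsub a ha) (hne a ha)
    have hp2 : ∀ a ∈ s, (Ideal.span {L i, L a}).IsPrime := fun a ha =>
      hL.prime_pair i hmem a (hsub a ha) (hne a ha)
    have hn2 : ∀ a ∈ s, ∀ b ∈ s, a ≠ b → L b ∉ Ideal.span {L i, L a} := fun a ha b hb hab =>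
      hL.notMem_pair i hmem a (hsub a ha) b (hsub b hb) (hne a ha) (hne b hb) hab
    have hPi : ∀ a ∈ s, P (Ideal.span {L i, L a}) := fun a ha =>
      hp i hmem a (hsub a ha) (hne a ha)
    -- Each old `(L a, L b) ^ 2` is primary and `L i` avoids its radical.
    have hcancel : ∀ x, L i * x ∈ pairIdeal L s 2 → x ∈ pairIdeal L s 2 := by
      intro x hx
      rw [mem_pairIdeal] at hx ⊢
      intro a ha b hb hab
      exact mem_span_pair_sq_of_mul_mem
        (hL.prime_single a (hsub a ha) b (hsub b hb) hab)
        (hL.notMem_single a (hsub a ha) b (hsub b hb) hab)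
        (hL.prime_pair a (hsub a ha) b (hsub b hb) hab)
        (hL.notMem_pair a (hsub a ha) b (hsub b hb) i hmem hab (hne a ha).symm (hne b hb).symm)
        (hx a ha b hb hab) (hL.ne_zero (hsub a ha) (hsub b hb) hab)
    have hmixed : P (mixedPairIdeal L s i) := by
      refine hP _ (pairIdeal L s 2) (L i) (fun x => ?_)
        (ih (hL.mono (Finset.subset_insert _ _)) fun a ha b hb => hp a (hsub a ha) b (hsub b hb)) ?_
      · rw [mem_mixedPairIdeal]
        exact ⟨fun h => hcancel x h.1, fun h => ⟨Ideal.mul_mem_left _ _ h,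
          fun a ha => Ideal.mul_mem_right _ _ (left_mem_span_pair _ _)⟩⟩
      · rw [sup_eq_span_pair (f := ∏ a ∈ s, L a)]
        · exact hP.span_pair_prod htop hs1 hn1 hPi
        · rw [mem_mixedPairIdeal, mem_pairIdeal]
          exact ⟨fun a ha b hb hab => prod_mem_span_pair_sq ha hb hab,
            fun a ha => prod_mem_span_pair ha _⟩
        · exact fun x hx => mem_span_pair_prod hp2 hn2 (mem_mixedPairIdeal.1 hx).2
    -- The first colon by `L i` lowers the new lines from multiplicity two to one; `hmixed` came
    -- from the second, which removes them.
    refine hP _ (mixedPairIdeal L s i) (L i) (fun x => ?_) hmixed ?_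
    · rw [mem_mixedPairIdeal, mem_pairIdeal_insert hi]
      refine ⟨fun h => ⟨hcancel x h.1, fun a ha => ?_⟩,
        fun h => ⟨Ideal.mul_mem_left _ _ h.1, fun a ha => ?_⟩⟩
      · exact (mul_mem_span_pair_sq_iff (hs1 a ha) (hn1 a ha) (hi0 a ha)).1 (h.2 a ha)
      · exact (mul_mem_span_pair_sq_iff (hs1 a ha) (hn1 a ha) (hi0 a ha)).2 (h.2 a ha)
    · rw [sup_eq_span_pair (f := (∏ a ∈ s, L a) ^ 2)]
      · exact hP.span_pair_prod_sq htop hs1 hn1 hPi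
      · rw [mem_pairIdeal_insert hi, mem_pairIdeal]
        exact ⟨fun a ha b hb hab => Ideal.pow_mem_of_mem _ (prod_mem_span_pair_sq ha hb hab) 2
          two_pos, fun a ha => Ideal.pow_mem_pow (prod_mem_span_pair ha _) 2⟩
      · intro x hx
        rw [mem_pairIdeal_insert hi] at hx
        -- Primality of `(L i)` is available only in the presence of a second plane; with none, the
        -- empty product is a unit.
        obtain rfl | ⟨a₀, ha₀⟩ := s.eq_empty_or_nonempty
        · simp [Ideal.span_insert]
        refine mem_span_pair_prod_sq (hs1 a₀ ha₀) hn1 hp2 hn2 fun a ha => ?_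
        -- Modulo `L i` only the term `r * L a ^ 2` survives.
        obtain ⟨p, q, r, rfl⟩ := mem_span_pair_sq.1 (hx.2 a ha)
        exact Ideal.mem_span_pair.2 ⟨p * L i + q * L a, r, by ring⟩

end

end PairIdeal

/-! ### Associated primes and the symbolic square -/

section Symbolic

variable {R ι : Type*} [CommRing R]

theorem mem_associatedPrimes_quotient_iff [IsNoetherianRing R] {I Q : Ideal R} :
    Q ∈ associatedPrimes R (R ⧸ I) ↔ Q.IsPrime ∧ ∃ x, ∀ r, r ∈ Q ↔ r * x ∈ I := by
  rw [AssociatedPrimes.mem_iff, isAssociatedPrime_iff]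
  refine and_congr_right fun _ => ⟨?_, ?_⟩
  · rintro ⟨x, rfl⟩
    obtain ⟨x, rfl⟩ := Ideal.Quotient.mk_surjective x
    refine ⟨x, fun r => ?_⟩
    rw [Submodule.mem_colon_singleton, Submodule.mem_bot, ← Ideal.Quotient.eq_zero_iff_mem]
    rfl
  · rintro ⟨x, hx⟩
    refine ⟨Ideal.Quotient.mk I x, Ideal.ext fun r => ?_⟩
    rw [hx, Submodule.mem_colon_singleton, Submodule.mem_bot, ← Ideal.Quotient.eq_zero_iff_mem]
    rfl

theorem mem_symbolicPower_iff {I : Ideal R} {m : ℕ} {x : R} :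
    x ∈ symbolicPower I m ↔
      ∀ Q ∈ associatedPrimes R (R ⧸ I), ∃ s, s ∉ Q ∧ s * x ∈ I ^ m := by
  simp only [symbolicPower, Submodule.mem_iInf, Subtype.forall, Ideal.mem_comap]
  refine forall₂_congr fun Q hQ => ?_
  have : Q.IsPrime := hQ.isPrime
  rw [IsLocalization.algebraMap_mem_map_algebraMap_iff Q.primeCompl]
  rfl

variable {L : ι → R} {s : Finset ι}

/-- Each `(L a, L b)` is the annihilator of an element modulo the pair ideal. -/
theorem PairwisePrime.exists_colon_eq (hL : PairwisePrime L s) {a b : ι} (ha : a ∈ s)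
    (hb : b ∈ s) (hab : a ≠ b) :
    ∃ t ∉ Ideal.span {L a, L b}, ∀ r ∈ Ideal.span {L a, L b}, r * t ∈ pairIdeal L s 1 := by
  classical
  -- The product of the remaining forms lies in the ideal of every other pair, since such a pair has
  -- an index outside `{a, b}`.
  refine ⟨∏ c ∈ (s.erase a).erase b, L c, fun h => ?_, fun r hr => ?_⟩
  · obtain ⟨c, hc, hc'⟩ := (hL.prime_pair a ha b hb hab).prod_mem_iff.1 h
    simp only [Finset.mem_erase] at hc
    exact hL.notMem_pair a ha b hb c hc.2.2 hab hc.2.1.symm hc.1.symm hc'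
  · simp only [mem_pairIdeal, pow_one]
    intro c hc d hd hcd
    by_cases hcab : c = a ∨ c = b
    · by_cases hdab : d = a ∨ d = b
      · have : ({L c, L d} : Set R) = {L a, L b} := by
          rcases hcab with rfl | rfl <;> rcases hdab with rfl | rfl
          · exact absurd rfl hcd
          · rfl
          · exact Set.pair_comm _ _
          · exact absurd rfl hcd
        rw [this]
        exact Ideal.mul_mem_right _ _ hr
      · push Not at hdab
        exact Ideal.mul_mem_left _ _ (prod_mem_span_pair (by simp [hdab, hd]) _)
    · push Not at hcab
      rw [Set.pair_comm]
      exact Ideal.mul_mem_left _ _ (prod_mem_span_pair (by simp [hcab, hc]) _)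

theorem PairwisePrime.mem_associatedPrimes_iff [IsNoetherianRing R] (hL : PairwisePrime L s)
    {Q : Ideal R} :
    Q ∈ associatedPrimes R (R ⧸ pairIdeal L s 1) ↔
      ∃ a ∈ s, ∃ b ∈ s, a ≠ b ∧ Q = Ideal.span {L a, L b} := by
  classical
  rw [mem_associatedPrimes_quotient_iff]
  constructor
  · rintro ⟨hQ, x, hx⟩
    simp only [mem_pairIdeal, pow_one] at hx
    let T : Finset (ι × ι) := (s ×ˢ s).filter fun p => p.1 ≠ p.2 ∧ x ∉ Ideal.span {L p.1, L p.2}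
    -- `Q` is the annihilator of `x`, so it contains the finite intersection of the pair primes that
    -- miss `x`; being prime, it contains one of them.
    have hT : T.inf (fun p => Ideal.span {L p.1, L p.2}) ≤ Q := by
      intro r hr
      rw [hx]
      intro a ha b hb hab
      by_cases hxab : x ∈ Ideal.span {L a, L b}
      · exact Ideal.mul_mem_left _ _ hxab
      · exact Ideal.mul_mem_right _ _
          (Finset.inf_le (f := fun p : ι × ι => Ideal.span {L p.1, L p.2}) (b := (a, b))
            (by simp [T, ha, hb, hab, hxab]) hr)
    obtain ⟨⟨a, b⟩, hab, hle⟩ := hQ.inf_le'.1 hT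
    simp only [T, Finset.mem_filter, Finset.mem_product] at hab
    obtain ⟨⟨ha, hb⟩, hne, hxab⟩ := hab
    refine ⟨a, ha, b, hb, hne, le_antisymm (fun r hr => ?_) hle⟩
    exact ((hL.prime_pair a ha b hb hne).mem_or_mem ((hx r).1 hr a ha b hb hne)).resolve_right hxab
  · rintro ⟨a, ha, b, hb, hab, rfl⟩
    have hprime := hL.prime_pair a ha b hb hab
    obtain ⟨t, ht, htI⟩ := hL.exists_colon_eq ha hb hab
    refine ⟨hprime, t, fun r => ⟨htI r, fun hr => (hprime.mem_or_mem ?_).resolve_right ht⟩⟩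
    simpa using mem_pairIdeal.1 hr a ha b hb hab

/-- The symbolic square of `⋂ (L a, L b)` is `⋂ (L a, L b) ^ 2`. -/
theorem PairwisePrime.symbolicPower_two [IsDomain R] [IsNoetherianRing R]
    (hL : PairwisePrime L s) :
    symbolicPower (pairIdeal L s 1) 2 = pairIdeal L s 2 := by
  ext x
  rw [mem_symbolicPower_iff, mem_pairIdeal]
  constructor
  · intro h a ha b hb hab
    obtain ⟨t, ht, htx⟩ := h _ (hL.mem_associatedPrimes_iff.2 ⟨a, ha, b, hb, hab, rfl⟩)
    refine mem_span_pair_sq_of_mul_mem (hL.prime_single a ha b hb hab)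
      (hL.notMem_single a ha b hb hab) (hL.prime_pair a ha b hb hab) ht
      (Ideal.pow_right_mono (fun y hy => ?_) 2 htx) (hL.ne_zero ha hb hab)
    simpa using mem_pairIdeal.1 hy a ha b hb hab
  · intro h Q hQ
    obtain ⟨a, ha, b, hb, hab, rfl⟩ := hL.mem_associatedPrimes_iff.1 hQ
    have hprime := hL.prime_pair a ha b hb hab
    obtain ⟨t, ht, htI⟩ := hL.exists_colon_eq ha hb hab
    -- `t` carries `(L a, L b)` into the pair ideal `I`, hence `t ^ 2` carries `(L a, L b) ^ 2` into
    -- `I ^ 2`.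
    refine ⟨t ^ 2, fun h' => ht (hprime.mem_of_pow_mem _ h'), ?_⟩
    obtain ⟨p, q, r, rfl⟩ := mem_span_pair_sq.1 (h a ha b hb hab)
    have h1 := htI _ (left_mem_span_pair (L a) (L b))
    have h2 := htI _ (right_mem_span_pair (L a) (L b))
    have : t ^ 2 * (p * L a ^ 2 + q * (L a * L b) + r * L b ^ 2) =
        p * (L a * t * (L a * t)) + q * (L a * t * (L b * t)) + r * (L b * t * (L b * t)) := by
      ring
    rw [this, pow_two]
    exact add_mem (add_mem (Ideal.mul_mem_left _ _ (Ideal.mul_mem_mul h1 h1))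
      (Ideal.mul_mem_left _ _ (Ideal.mul_mem_mul h1 h2)))
      (Ideal.mul_mem_left _ _ (Ideal.mul_mem_mul h2 h2))

end Symbolic

/-! ### Depth, dimension and regular sequences -/

section DepthDim

open IsLocalRing RingTheory.Sequence
open scoped Pointwise

/-- Dividing by a regular sequence lowers the dimension by its length, and the quotient, being
nonzero, has dimension at least 0. -/
theorem localDepth_le_ringKrullDim (R : Type*) [CommRing R] [IsLocalRing R] [IsNoetherianRing R] :
    (localDepth R : WithBot ℕ∞) ≤ ringKrullDim R := by
  obtain ⟨d, hd⟩ := WithBot.ne_bot_iff_exists.1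
    (ne_bot_of_le_ne_bot WithBot.zero_ne_bot (ringKrullDim_nonneg_of_nontrivial (R := R)))
  rw [← hd, WithBot.coe_le_coe]
  refine iSup₂_le fun rs hrs => ?_
  have h := ringKrullDim_add_length_eq_ringKrullDim_of_isRegular rs hrs.2
  have hlt : Ideal.ofList rs ≠ ⊤ := by simpa using hrs.2.2.symm
  have : Nontrivial (R ⧸ Ideal.ofList rs) := Ideal.Quotient.nontrivial_iff.2 hlt
  have h0 := ringKrullDim_nonneg_of_nontrivial (R := R ⧸ Ideal.ofList rs)
  rw [← WithBot.coe_le_coe, hd, ← h]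
  simpa using add_le_add_left h0 (rs.length : WithBot ℕ∞)

/-- A Noetherian local ring with a regular sequence of length at least its dimension is
Cohen–Macaulay. -/
theorem IsCohenMacaulayLocal.of_isRegular {R : Type*} [CommRing R] [IsLocalRing R]
    [IsNoetherianRing R] (rs : List R) (hmem : ∀ r ∈ rs, r ∈ maximalIdeal R)
    (hrs : IsRegular R rs) (hdim : ringKrullDim R ≤ rs.length) : IsCohenMacaulayLocal R where
  noetherian := inferInstance
  depth_eq_dim := by
    refine le_antisymm (localDepth_le_ringKrullDim R) (hdim.trans ?_)
    have : (rs.length : ℕ∞) ≤ localDepth R :=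
      le_iSup₂ (f := fun (rs : List R) (_ : (∀ r ∈ rs, r ∈ maximalIdeal R) ∧ IsRegular R rs) =>
        (rs.length : ℕ∞)) rs ⟨hmem, hrs⟩
    exact_mod_cast this

/-- By incomparability, contraction of primes along an integral map is strictly monotone. -/
theorem ringKrullDim_le_of_isIntegral {A R : Type*} [CommRing A] [CommRing R] (f : A →+* R)
    (hf : f.IsIntegral) : ringKrullDim R ≤ ringKrullDim A := by
  let _ := f.toAlgebra
  have : Algebra.IsIntegral A R := ⟨hf⟩
  refine Order.krullDim_le_of_strictMono (PrimeSpectrum.comap f) fun p q hpq => ?_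
  exact Ideal.IsIntegral.comap_lt_comap (R := A) (A := R) (I := p.asIdeal) (J := q.asIdeal) hpq

theorem ringKrullDim_localization_atPrime_le {R : Type*} [CommRing R] (p : Ideal R) [p.IsPrime] :
    ringKrullDim (Localization.AtPrime p) ≤ ringKrullDim R := by
  rw [IsLocalization.AtPrime.ringKrullDim_eq_height p]
  exact Ideal.height_le_ringKrullDim_of_ne_top Ideal.IsPrime.ne_top'

theorem isWeaklyRegular_quotient_pair {R : Type*} [CommRing R] {J : Ideal R} {u v : R}
    (hu : ∀ x, u * x ∈ J → x ∈ J)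
    (hv : ∀ x, v * x ∈ J ⊔ Ideal.span {u} → x ∈ J ⊔ Ideal.span {u}) :
    IsWeaklyRegular (R ⧸ J) [Ideal.Quotient.mk J u, Ideal.Quotient.mk J v] := by
  have key : ∀ x : R, x ∈ J ⊔ Ideal.span {u} ↔
      Ideal.Quotient.mk J x ∈ Ideal.span {Ideal.Quotient.mk J u} := by
    intro x
    rw [← Ideal.mem_comap, ← Set.image_singleton, ← Ideal.map_span,
      Ideal.comap_map_of_surjective _ Ideal.Quotient.mk_surjective, ← RingHom.ker_eq_comap_bot,
      Ideal.mk_ker, sup_comm]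
  rw [isWeaklyRegular_cons_iff', List.map_singleton, isWeaklyRegular_singleton_iff]
  constructor
  · rw [isSMulRegular_iff_right_eq_zero_of_smul]
    intro x
    obtain ⟨x, rfl⟩ := Ideal.Quotient.mk_surjective x
    rw [smul_eq_mul, ← map_mul, Ideal.Quotient.eq_zero_iff_mem, Ideal.Quotient.eq_zero_iff_mem]
    exact hu x
  · rw [isSMulRegular_iff_right_eq_zero_of_smul]
    intro x
    obtain ⟨x, rfl⟩ := Submodule.mkQ_surjective _ x
    obtain ⟨x, rfl⟩ := Ideal.Quotient.mk_surjective x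
    intro h
    have e : (Ideal.Quotient.mk J u • (⊤ : Submodule (R ⧸ J) (R ⧸ J))) =
        Ideal.span {Ideal.Quotient.mk J u} := by
      rw [← Submodule.ideal_span_singleton_smul]
      simp
    rw [Submodule.mkQ_apply, Submodule.Quotient.mk_eq_zero, e, ← key]
    apply hv
    rw [key, ← e, map_mul, ← Submodule.Quotient.mk_eq_zero]
    exact h

end DepthDim

/-! ### The property carried through extensions, and why it implies Cohen–Macaulayness -/

section Parameters

open MvPolynomial

variable {k σ : Type*} [Field k]

/-- The quotient of a polynomial ring by `J` is integral over `k[u, v]`, and every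
`u - a, v - b` with `a, b ∈ k` is a weakly regular sequence on it. -/
structure HasRegularParameters (u v : MvPolynomial σ k) (J : Ideal (MvPolynomial σ k)) : Prop where
  integral : ∀ x, ∃ p : Polynomial (MvPolynomial (Fin 2) k),
    p.Monic ∧ p.eval₂ (aeval ![u, v] : _ →ₐ[k] MvPolynomial σ k).toRingHom x ∈ J
  regular_left : ∀ a x, (u - C a) * x ∈ J → x ∈ J
  regular_right : ∀ a b x, (v - C b) * x ∈ J ⊔ Ideal.span {u - C a} →
    x ∈ J ⊔ Ideal.span {u - C a}

theorem HasRegularParameters.top (u v : MvPolynomial σ k) : HasRegularParameters u v ⊤ :=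
  ⟨fun _ => ⟨1, Polynomial.monic_one, trivial⟩, fun _ _ _ => trivial, fun _ _ _ _ => by simp⟩

/-- Monic equations for the outer terms multiply to one for the middle term. Regularity of `u - a`
passes to the middle term. As `u - a` is regular on the right-hand term, the sequence stays exact
modulo `u - a`, so the same argument applies to `v - b`. -/
theorem HasRegularParameters.extensionClosed (u v : MvPolynomial σ k) :
    ExtensionClosed (HasRegularParameters u v) := by
  intro J K h hK HK HJ
  refine ⟨fun x => ?_, fun a x hx => ?_, fun a b x hx => ?_⟩
  · obtain ⟨p, hp, hpx⟩ := HJ.integral x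
    obtain ⟨q, hq, hqx⟩ := HK.integral x
    refine ⟨q * p, hq.mul hp, ?_⟩
    rw [Polynomial.eval₂_mul]
    obtain ⟨j, hj, y, hy, hjy⟩ := Submodule.mem_sup.1 hpx
    obtain ⟨z, rfl⟩ := Ideal.mem_span_singleton'.1 hy
    rw [← hjy, mul_add]
    refine add_mem (Ideal.mul_mem_left _ _ hj) ?_
    have := Ideal.mul_mem_left J z ((hK _).2 hqx)
    convert this using 1
    ring
  · obtain ⟨j, hj, y, hy, rfl⟩ := Submodule.mem_sup.1
      (HJ.regular_left a x (Ideal.mem_sup_left hx))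
    obtain ⟨z, rfl⟩ := Ideal.mem_span_singleton'.1 hy
    refine add_mem hj ?_
    rw [mul_comm, hK]
    refine HK.regular_left a z ((hK _).1 ?_)
    have := sub_mem hx (Ideal.mul_mem_left _ (u - C a) hj)
    convert this using 1
    ring
  · have h1 : x ∈ J ⊔ Ideal.span {h} ⊔ Ideal.span {u - C a} :=
      HJ.regular_right a b x ((sup_le_sup_right le_sup_left _ : J ⊔ _ ≤ _) hx)
    obtain ⟨x', hx', w, hw, rfl⟩ := Submodule.mem_sup.1 h1
    obtain ⟨j, hj, y', hy', rfl⟩ := Submodule.mem_sup.1 hx'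
    obtain ⟨y, rfl⟩ := Ideal.mem_span_singleton'.1 hy'
    have hjw : j + w ∈ J ⊔ Ideal.span {u - C a} := Submodule.add_mem_sup hj hw
    suffices y * h ∈ J ⊔ Ideal.span {u - C a} by
      have := Ideal.add_mem _ this hjw
      convert this using 1
      ring
    have h2 : (v - C b) * (y * h) ∈ J ⊔ Ideal.span {u - C a} := by
      have := Ideal.sub_mem _ hx (Ideal.mul_mem_left _ (v - C b) hjw)
      convert this using 1
      ring
    obtain ⟨j', hj', w', hw', hjw⟩ := Submodule.mem_sup.1 h2
    obtain ⟨w', rfl⟩ := Ideal.mem_span_singleton'.1 hw'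
    -- This is the exactness modulo `u - a`: regularity of `u - a` on `R/(J + (h))` gives `w' = j''
    -- + t * h`, and then `h * ((v - b) * y - t * (u - a)) ∈ J`.
    have h3 : w' ∈ J ⊔ Ideal.span {h} := by
      refine HJ.regular_left a w' ?_
      have := Ideal.sub_mem _ (Ideal.mul_mem_left _ ((v - C b) * y)
        (Ideal.mem_sup_right (Ideal.mem_span_singleton_self h) : h ∈ J ⊔ Ideal.span {h}))
        (Ideal.mem_sup_left hj')
      convert this using 1
      linear_combination hjw
    obtain ⟨j'', hj'', t, ht, rfl⟩ := Submodule.mem_sup.1 h3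
    obtain ⟨t, rfl⟩ := Ideal.mem_span_singleton'.1 ht
    have h4 : (v - C b) * y - t * (u - C a) ∈ K := by
      rw [← hK]
      have := Ideal.add_mem _ hj' (Ideal.mul_mem_left _ (u - C a) hj'')
      convert this using 1
      linear_combination -hjw
    have h5 : y ∈ K ⊔ Ideal.span {u - C a} := by
      refine HK.regular_right a b y ?_
      have := Submodule.add_mem_sup h4
        (Ideal.mul_mem_left _ t (Ideal.mem_span_singleton_self (u - C a)))
      convert this using 1
      ring
    obtain ⟨z, hz, w'', hw'', rfl⟩ := Submodule.mem_sup.1 h5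
    rw [add_mul]
    refine Submodule.add_mem_sup ?_ (Ideal.mul_mem_right _ _ hw'')
    rw [mul_comm]
    exact (hK z).2 hz

theorem HasRegularParameters.isCohenMacaulay [Finite σ] [IsAlgClosed k] {u v : MvPolynomial σ k}
    {J : Ideal (MvPolynomial σ k)} (hJ : HasRegularParameters u v J) :
    IsCohenMacaulay (MvPolynomial σ k ⧸ J) where
  noetherian := inferInstance
  localization m hm := by
    have : (m.comap (Ideal.Quotient.mk J)).IsMaximal :=
      Ideal.comap_isMaximal_of_surjective _ Ideal.Quotient.mk_surjective
    -- By the Nullstellensatz the maximal ideal is that of a point `P`, so it contains `u - u(P)`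
    -- and `v - v(P)`.
    obtain ⟨P, hP⟩ := (isMaximal_iff_eq_vanishingIdeal_singleton (K := k)).1 this
    have hmem : ∀ w : MvPolynomial σ k, Ideal.Quotient.mk J (w - C (eval P w)) ∈ m := by
      intro w
      rw [← Ideal.mem_comap, hP, mem_vanishingIdeal_singleton_iff]
      simp [aeval_eq_eval]
    have hreg := isWeaklyRegular_quotient_pair (hJ.regular_left (eval P u))
      (hJ.regular_right (eval P u) (eval P v))
    have hreg' := hreg.isRegular_of_isLocalization_of_mem (Localization.AtPrime m) m
      (by simpa using ⟨hmem u, hmem v⟩)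
    refine IsCohenMacaulayLocal.of_isRegular _ ?_ hreg' ?_
    · simp only [List.map_cons, List.map_nil, List.mem_cons, List.not_mem_nil, or_false,
        forall_eq_or_imp, forall_eq, IsLocalization.AtPrime.to_map_mem_maximal_iff _ m]
      exact ⟨hmem u, hmem v⟩
    -- Integrality over `k[u, v]` bounds the dimension by 2, the length of the sequence.
    · refine (ringKrullDim_localization_atPrime_le m).trans ?_
      refine (ringKrullDim_le_of_isIntegral ((Ideal.Quotient.mk J).comp
        (aeval ![u, v] : _ →ₐ[k] MvPolynomial σ k).toRingHom) fun x => ?_).trans ?_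
      · obtain ⟨x, rfl⟩ := Ideal.Quotient.mk_surjective x
        obtain ⟨p, hp, hpx⟩ := hJ.integral x
        refine ⟨p, hp, ?_⟩
        rw [← Polynomial.hom_eval₂, Ideal.Quotient.eq_zero_iff_mem]
        exact hpx
      · simp

end Parameters

/-- A surjective endomorphism of a Noetherian commutative ring is injective. -/
theorem IsNoetherianRing.injective_of_surjective_ringHom {R : Type*} [CommRing R]
    [IsNoetherianRing R] (f : R →+* R) (hf : Function.Surjective f) : Function.Injective f := by
  have hmono : Monotone fun n : ℕ => RingHom.ker (f ^ n) := by
    refine monotone_nat_of_le_succ fun n x hx => ?_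
    rw [RingHom.mem_ker] at hx ⊢
    rw [pow_succ', RingHom.mul_def, RingHom.comp_apply, hx, map_zero]
  obtain ⟨n, hn⟩ := monotone_stabilizes_iff_noetherian.2 (inferInstanceAs (IsNoetherian R R))
    ⟨_, hmono⟩
  have hsurj : Function.Surjective (f ^ n) := by
    rw [RingHom.coe_pow]
    exact hf.iterate n
  refine (injective_iff_map_eq_zero f).2 fun x hx => ?_
  obtain ⟨y, rfl⟩ := hsurj x
  have h1 : y ∈ RingHom.ker (f ^ (n + 1)) := by
    rw [RingHom.mem_ker, pow_succ', RingHom.mul_def, RingHom.comp_apply, hx]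
  have h2 : RingHom.ker (f ^ n) = RingHom.ker (f ^ (n + 1)) := hn (n + 1) n.le_succ
  rwa [← h2] at h1

/-! ### Linear forms as affine coordinates -/

section LinearForms

open MvPolynomial

variable {k : Type*} [Field k] {n : ℕ}

/-- The linear form, as a polynomial, of a linear functional on `kⁿ`. -/
noncomputable def linForm : Module.Dual k (Fin n → k) →ₗ[k] MvPolynomial (Fin n) k where
  toFun c := ∑ i, c (Pi.single i 1) • X i
  map_add' c d := by simp [add_smul, Finset.sum_add_distrib]
  map_smul' r c := by simp [mul_smul, Finset.smul_sum]

theorem linForm_apply (c : Module.Dual k (Fin n → k)) :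
    linForm c = ∑ i, c (Pi.single i 1) • (X i : MvPolynomial (Fin n) k) := rfl

@[simp]
theorem eval_linForm (c : Module.Dual k (Fin n → k)) (x : Fin n → k) :
    eval x (linForm c) = c x := by
  rw [LinearMap.pi_apply_eq_sum_univ c x, linForm_apply, map_sum]
  exact Finset.sum_congr rfl fun i _ => by
    have : (fun j => if i = j then (1 : k) else 0) = Pi.single i 1 := by
      ext j
      simp [Pi.single_apply, eq_comm]
    simp [smul_eval, mul_comm, this]

theorem linForm_proj (i : Fin n) :
    linForm (LinearMap.proj i : Module.Dual k (Fin n → k)) = X i := by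
  simp [linForm_apply, Pi.single_apply]

theorem isHomogeneous_linForm (c : Module.Dual k (Fin n → k)) : (linForm c).IsHomogeneous 1 := by
  rw [linForm_apply]
  refine IsHomogeneous.sum _ _ _ fun i _ => ?_
  rw [smul_eq_C_mul]
  simpa using (isHomogeneous_C (Fin n) (c (Pi.single i 1))).mul (isHomogeneous_X k i)

variable {c : Fin n → Module.Dual k (Fin n → k)}

theorem LinearIndependent.span_dual_eq_top (hc : LinearIndependent k c) :
    Submodule.span k (Set.range c) = ⊤ :=
  hc.span_eq_top_of_card_eq_finrank' (by simp)

theorem LinearIndependent.exists_dual_apply_eq (hc : LinearIndependent k c) (t : Fin n → k) :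
    ∃ x, ∀ i, c i x = t i := by
  have hinj : Function.Injective (LinearMap.pi c) := by
    refine (injective_iff_map_eq_zero _).2 fun x hx => ?_
    have hle : Submodule.span k (Set.range c) ≤
        LinearMap.ker (Module.Dual.eval k (Fin n → k) x) := by
      refine Submodule.span_le.2 ?_
      rintro _ ⟨i, rfl⟩
      exact congr_fun hx i
    rw [hc.span_dual_eq_top] at hle
    ext i
    exact hle (x := LinearMap.proj i) trivial
  obtain ⟨x, hx⟩ := (LinearMap.injective_iff_surjective.1 hinj) t
  exact ⟨x, fun i => congr_fun hx i⟩

/-- Linearly independent linear functionals are affine coordinates around every point. -/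
theorem exists_affine_coordinates (hc : LinearIndependent k c) (a : Fin n → k) :
    ∃ e : MvPolynomial (Fin n) k ≃ₐ[k] MvPolynomial (Fin n) k,
      ∀ i, e (X i) = linForm (c i) - C (a i) := by
  let f : MvPolynomial (Fin n) k →ₐ[k] MvPolynomial (Fin n) k :=
    aeval fun i => linForm (c i) - C (a i)
  have hlin : ∀ i, linForm (c i) ∈ f.range := fun i => by
    have h1 : f (X i + C (a i)) = linForm (c i) := by simp [f, algebraMap_eq]
    exact ⟨_, h1⟩
  have hle : Submodule.span k (Set.range c) ≤
      (Subalgebra.toSubmodule f.range).comap linForm := by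
    refine Submodule.span_le.2 ?_
    rintro _ ⟨i, rfl⟩
    exact hlin i
  rw [hc.span_dual_eq_top] at hle
  -- The range contains the forms of a basis of the dual space, hence all linear forms, in
  -- particular the variables.
  have hsurj : Function.Surjective f := by
    rw [← AlgHom.range_eq_top, eq_top_iff, ← adjoin_range_X, Algebra.adjoin_le_iff]
    rintro _ ⟨i, rfl⟩
    rw [← linForm_proj]
    exact hle (x := LinearMap.proj i) trivial
  have hbij : Function.Bijective f :=
    ⟨IsNoetherianRing.injective_of_surjective_ringHom f.toRingHom hsurj, hsurj⟩
  exact ⟨AlgEquiv.ofBijective f hbij, fun i => by simp [f]⟩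

/-- The ideal is the kernel of the substitution that sets the variables in `s` to zero, a map to a
domain. -/
theorem isPrime_span_X_image {σ : Type*} (s : Set σ) :
    (Ideal.span (X '' s : Set (MvPolynomial σ k))).IsPrime := by
  classical
  let φ : MvPolynomial σ k →ₐ[k] MvPolynomial σ k := aeval fun i => if i ∈ s then 0 else X i
  have hφ : (Ideal.Quotient.mkₐ k (Ideal.span (X '' s))).comp φ =
      Ideal.Quotient.mkₐ k (Ideal.span (X '' s)) := by
    ext i
    by_cases hi : i ∈ s
    · have : (X i : MvPolynomial σ k) ∈ Ideal.span (X '' s) :=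
        Ideal.subset_span (Set.mem_image_of_mem _ hi)
      simpa [φ, hi] using (Ideal.Quotient.eq_zero_iff_mem.2 this).symm
    · simp [φ, hi]
  have hker : Ideal.span (X '' s) = RingHom.ker φ := by
    refine le_antisymm (Ideal.span_le.2 ?_) fun f hf => ?_
    · rintro _ ⟨i, hi, rfl⟩
      simp [φ, hi]
    · rw [← Ideal.Quotient.eq_zero_iff_mem]
      have := DFunLike.congr_fun hφ f
      simpa [(RingHom.mem_ker).1 hf] using this.symm
  rw [hker]
  exact RingHom.ker_isPrime _

theorem X_notMem_span_X_image {σ : Type*} {s : Set σ} {i : σ} (hi : i ∉ s) :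
    (X i : MvPolynomial σ k) ∉ Ideal.span (X '' s) := by
  classical
  rw [mem_ideal_span_X_image]
  intro h
  obtain ⟨j, hj, hj'⟩ := h (Finsupp.single i 1) (by simp)
  refine hj' (Finsupp.single_eq_of_ne ?_)
  rintro rfl
  exact hi hj

theorem span_image_eq_map {ι R S : Type*} [CommRing R] [CommRing S] (e : R ≃+* S) {f : ι → R}
    {g : ι → S} (h : ∀ i, e (f i) = g i) (s : Set ι) :
    Ideal.span (g '' s) = (Ideal.span (f '' s)).map (e : R →+* S) := by
  rw [Ideal.map_span, Set.image_image]
  congr 1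
  exact Set.image_congr fun i _ => (h i).symm

theorem isPrime_span_linForm_sub (hc : LinearIndependent k c) (a : Fin n → k) (s : Set (Fin n)) :
    (Ideal.span ((fun i => linForm (c i) - C (a i)) '' s)).IsPrime := by
  obtain ⟨e, he⟩ := exists_affine_coordinates hc a
  have := isPrime_span_X_image (k := k) s
  rw [span_image_eq_map e.toRingEquiv he s]
  exact Ideal.map_isPrime_of_equiv e.toRingEquiv

theorem linForm_sub_notMem_span (hc : LinearIndependent k c) (a : Fin n → k) {s : Set (Fin n)}
    {i : Fin n} (hi : i ∉ s) :
    linForm (c i) - C (a i) ∉ Ideal.span ((fun i => linForm (c i) - C (a i)) '' s) := by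
  obtain ⟨e, he⟩ := exists_affine_coordinates hc a
  rw [span_image_eq_map e.toRingEquiv he s, ← he i]
  intro h
  refine X_notMem_span_X_image (k := k) hi ?_
  have := Ideal.mem_map_of_equiv e.toRingEquiv (I := Ideal.span (X '' s)) (e (X i))
  obtain ⟨y, hy, hy'⟩ := this.1 h
  exact e.injective hy' ▸ hy

end LinearForms

/-! ### The ideal of a single line -/

section Line

open MvPolynomial

variable {k : Type*} [Field k] {c₁ c₂ u v : Module.Dual k (Fin 4 → k)}

theorem LinearIndependent.isPrime_span_single (hc : LinearIndependent k ![c₁, c₂, u, v]) :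
    (Ideal.span {linForm c₁}).IsPrime := by
  simpa using isPrime_span_linForm_sub hc 0 {0}

theorem LinearIndependent.notMem_span_single (hc : LinearIndependent k ![c₁, c₂, u, v]) :
    linForm c₂ ∉ Ideal.span {linForm c₁} := by
  simpa using linForm_sub_notMem_span hc 0 (s := {0}) (i := 1) (by simp)

theorem LinearIndependent.isPrime_span_pair (hc : LinearIndependent k ![c₁, c₂, u, v]) :
    (Ideal.span {linForm c₁, linForm c₂}).IsPrime := by
  simpa [Set.image_insert_eq] using isPrime_span_linForm_sub hc 0 {0, 1}

/-- Modulo two linear forms, every polynomial in four variables is a polynomial in two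
complementary linear forms. -/
theorem LinearIndependent.exists_sub_aeval_mem (hc : LinearIndependent k ![c₁, c₂, u, v])
    (f : MvPolynomial (Fin 4) k) : ∃ q : MvPolynomial (Fin 2) k,
      f - aeval ![linForm u, linForm v] q ∈ Ideal.span {linForm c₁, linForm c₂} := by
  obtain ⟨e, he⟩ := exists_affine_coordinates hc 0
  obtain ⟨y, rfl⟩ := e.surjective f
  -- In the coordinates `c₁, c₂, u, v`, set the first two to zero.
  refine ⟨aeval ![0, 0, X 0, X 1] y, ?_⟩
  rw [← Ideal.Quotient.mk_eq_mk_iff_sub_mem]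
  let π := Ideal.Quotient.mkₐ k (Ideal.span {linForm c₁, linForm c₂})
  have h₁ : π (linForm c₁) = 0 := Ideal.Quotient.eq_zero_iff_mem.2 (left_mem_span_pair _ _)
  have h₂ : π (linForm c₂) = 0 := Ideal.Quotient.eq_zero_iff_mem.2 (right_mem_span_pair _ _)
  have h : π.comp e.toAlgHom =
      π.comp ((aeval ![linForm u, linForm v]).comp (aeval ![0, 0, X 0, X 1])) := by
    ext i
    fin_cases i <;> simp [he, h₁, h₂]
  exact DFunLike.congr_fun h y

/-- The quotient is the image of `k[u, v]`, so a monic equation of degree one suffices. As `c₁, c₂,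
u - a, v - b` are affine coordinates, any subset of them generates a prime ideal that omits the
others. -/
theorem LinearIndependent.hasRegularParameters (hc : LinearIndependent k ![c₁, c₂, u, v]) :
    HasRegularParameters (linForm u) (linForm v) (Ideal.span {linForm c₁, linForm c₂}) where
  integral x := by
    obtain ⟨q, hq⟩ := hc.exists_sub_aeval_mem x
    refine ⟨Polynomial.X - Polynomial.C q, Polynomial.monic_X_sub_C q, ?_⟩
    simpa using hq
  regular_left a x hx := by
    have h := linForm_sub_notMem_span hc ![0, 0, a, 0] (s := {0, 1}) (i := 2) (by simp)
    refine (hc.isPrime_span_pair.mem_or_mem hx).resolve_left ?_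
    simpa [Set.image_insert_eq] using h
  regular_right a b x hx := by
    have hp := isPrime_span_linForm_sub hc ![0, 0, a, b] {0, 1, 2}
    have h := linForm_sub_notMem_span hc ![0, 0, a, b] (s := {0, 1, 2}) (i := 3) (by simp)
    have e : Ideal.span {linForm c₁, linForm c₂} ⊔ Ideal.span {linForm u - C a} =
        Ideal.span ((fun i => linForm (![c₁, c₂, u, v] i) - C (![0, 0, a, b] i)) ''
          ({0, 1, 2} : Set (Fin 4))) := by
      rw [← Ideal.span_union]
      congr 1
      ext y
      simp [Set.image_insert_eq]
      tauto
    rw [e] at hx ⊢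
    exact (hp.mem_or_mem hx).resolve_left (by simpa using h)

/-- A polynomial vanishing at all nonzero points of a linear subspace of codimension two lies in
the ideal of the two linear forms. -/
theorem LinearIndependent.mem_span_pair_of_eval_eq_zero [Infinite k]
    (hc : LinearIndependent k ![c₁, c₂, u, v]) {f : MvPolynomial (Fin 4) k}
    (hf : ∀ x ≠ 0, c₁ x = 0 → c₂ x = 0 → eval x f = 0) :
    f ∈ Ideal.span {linForm c₁, linForm c₂} := by
  obtain ⟨q, hq⟩ := hc.exists_sub_aeval_mem f
  obtain ⟨α, β, hαβ⟩ := Ideal.mem_span_pair.1 hq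
  -- The factor `X 0` accounts for the excluded origin: where it is nonzero the point `x` is
  -- nonzero, and elsewhere the product vanishes anyway.
  have hzero : X 0 * q = 0 := by
    refine MvPolynomial.funext fun t => ?_
    obtain ⟨x, hx⟩ := hc.exists_dual_apply_eq ![0, 0, t 0, t 1]
    have h₁ : c₁ x = 0 := hx 0
    have h₂ : c₂ x = 0 := hx 1
    have h₃ : u x = t 0 := hx 2
    have h₄ : v x = t 1 := hx 3
    by_cases ht : t 0 = 0
    · simp [ht]
    have hx0 : x ≠ 0 := by
      rintro rfl
      exact ht (by simpa using h₃.symm)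
    have h := congrArg (eval x) hαβ
    simp only [map_add, map_mul, map_sub, eval_linForm, h₁, h₂, hf x hx0 h₁ h₂] at h
    have hq' : eval x (aeval ![linForm u, linForm v] q) = eval t q := by
      rw [← MvPolynomial.coe_aeval_eq_eval, ← MvPolynomial.coe_aeval_eq_eval]
      change ((aeval x).comp (aeval ![linForm u, linForm v])) q = aeval t q
      congr 1
      ext i
      fin_cases i <;> simp [aeval_eq_eval, h₃, h₄]
    rw [hq'] at h
    have : eval t q = 0 := by simpa using h
    simp [this]
  have : q = 0 := (mul_eq_zero.1 hzero).resolve_left (X_ne_zero 0)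
  simpa [this] using hq

theorem eval_eq_zero_of_mem_span_pair {f : MvPolynomial (Fin 4) k}
    (hf : f ∈ Ideal.span {linForm c₁, linForm c₂}) {x : Fin 4 → k} (h₁ : c₁ x = 0)
    (h₂ : c₂ x = 0) : eval x f = 0 := by
  obtain ⟨α, β, rfl⟩ := Ideal.mem_span_pair.1 hf
  simp [h₁, h₂]

/-- A vector space over an infinite field is not a finite union of proper subspaces, so one vector
extends all the families at once. -/
theorem LinearIndependent.exists_generic_extension [Infinite k] {ι : Type*} (T : Finset ι)
    {n : ℕ} {V : Type*} [AddCommGroup V] [Module k V] [FiniteDimensional k V]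
    (hn : n < Module.finrank k V) {w : ι → Fin n → V} (hw : ∀ i ∈ T, LinearIndependent k (w i)) :
    ∃ u : V, ∀ i ∈ T, LinearIndependent k (Fin.snoc (w i) u : Fin (n + 1) → V) := by
  classical
  have h := Subspace.biUnion_ne_univ_of_top_notMem (k := k) (E := V)
    (s := T.image fun i => Submodule.span k (Set.range (w i))) (by
      simp only [Finset.mem_image, not_exists, not_and]
      intro i hi htop
      have h1 := finrank_range_le_card (R := k) (w i)
      rw [Set.finrank, htop, finrank_top, Fintype.card_fin] at h1
      omega)
  obtain ⟨u, hu⟩ := (Set.ne_univ_iff_exists_notMem _).1 h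
  refine ⟨u, fun i hi => (hw i hi).finSnoc fun hmem => hu ?_⟩
  simp only [Set.mem_iUnion, Finset.mem_image]
  exact ⟨_, ⟨i, hi, rfl⟩, hmem⟩

end Line

/-! ### From planes and lines to ideals -/

section Geometry

open MvPolynomial Projectivization

variable {k : Type*} [Field k]

theorem MvPolynomial.IsHomogeneous.eval_smul_point {σ : Type*} [Fintype σ]
    {f : MvPolynomial σ k} {n : ℕ} (hf : f.IsHomogeneous n) (a : k) (x : σ → k) :
    eval (a • x) f = a ^ n * eval x f := by
  rw [eval_eq', eval_eq', Finset.mul_sum]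
  refine Finset.sum_congr rfl fun d hd => ?_
  have hdeg : ∑ i, d i = n := by
    have := hf (mem_support_iff.1 hd)
    rw [Finsupp.weight_apply, Finsupp.sum_fintype _ _ (by simp)] at this
    simpa using this
  simp only [Pi.smul_apply, smul_eq_mul, mul_pow, Finset.prod_mul_distrib, Finset.prod_pow_eq_pow_sum,
    hdeg]
  ring

theorem MvPolynomial.IsHomogeneous.eval_rep_eq_zero_iff {σ : Type*} [Fintype σ]
    {f : MvPolynomial σ k} {n : ℕ} (hf : f.IsHomogeneous n) {x : σ → k} (hx : x ≠ 0) :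
    eval (Projectivization.mk k x hx).rep f = 0 ↔ eval x f = 0 := by
  obtain ⟨a, ha⟩ := Projectivization.exists_smul_eq_mk_rep k x hx
  rw [← ha, Units.smul_def, hf.eval_smul_point]
  simp

theorem mem_inf_iff {H₁ H₂ : Projectivization.Subspace k (Fin 4 → k)} {P : ℙ k (Fin 4 → k)} :
    P ∈ H₁ ⊓ H₂ ↔ P ∈ H₁ ∧ P ∈ H₂ :=
  Iff.rfl

theorem submodule_inf (H₁ H₂ : Projectivization.Subspace k (Fin 4 → k)) :
    Subspace.submodule (H₁ ⊓ H₂) = Subspace.submodule H₁ ⊓ Subspace.submodule H₂ := by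
  ext x
  by_cases hx : x = 0
  · simp [hx]
  · rw [Submodule.mem_inf, Subspace.mem_submodule_iff _ hx, Subspace.mem_submodule_iff _ hx,
      Subspace.mem_submodule_iff _ hx, mem_inf_iff]

theorem rep_mem_submodule {H : Projectivization.Subspace k (Fin 4 → k)} {P : ℙ k (Fin 4 → k)}
    (hP : P ∈ H) : P.rep ∈ Projectivization.Subspace.submodule H := by
  rw [Projectivization.Subspace.mem_submodule_iff H P.rep_nonzero, P.mk_rep]
  exact hP

/-- Every plane is the zero locus of a linear form. -/
theorem IsPlane.exists_ker_eq {H : Projectivization.Subspace k (Fin 4 → k)} (hH : IsPlane H) :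
    ∃ c : Module.Dual k (Fin 4 → k), LinearMap.ker c = Projectivization.Subspace.submodule H := by
  have hH' : Module.finrank k (Projectivization.Subspace.submodule H) = 3 := hH
  have hlt : Projectivization.Subspace.submodule H < ⊤ := by
    rw [lt_top_iff_ne_top]
    intro h
    rw [h, finrank_top] at hH'
    simp at hH'
  obtain ⟨c, hc, hle⟩ := Submodule.exists_le_ker_of_lt_top _ hlt
  refine ⟨c, (Submodule.eq_of_le_of_finrank_eq hle ?_).symm⟩
  have := Module.Dual.finrank_ker_add_one_of_ne_zero hc
  simp at this
  omega

theorem IsPlane.eq_of_le {H₁ H₂ : Projectivization.Subspace k (Fin 4 → k)} (h₁ : IsPlane H₁)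
    (h₂ : IsPlane H₂) (h : Subspace.submodule H₁ ≤ Subspace.submodule H₂) : H₁ = H₂ :=
  Subspace.submodule.injective
    (Submodule.eq_of_le_of_finrank_eq h (Eq.trans h₁ (Eq.symm h₂)))

/-- Two distinct planes meet in a line. -/
theorem IsPlane.isLine_inf {H₁ H₂ : Projectivization.Subspace k (Fin 4 → k)} (h₁ : IsPlane H₁)
    (h₂ : IsPlane H₂) (hne : H₁ ≠ H₂) : IsLine (H₁ ⊓ H₂) := by
  have h₁' : Module.finrank k (Subspace.submodule H₁) = 3 := h₁
  have h₂' : Module.finrank k (Subspace.submodule H₂) = 3 := h₂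
  have hdim := Submodule.finrank_sup_add_finrank_inf_eq (Subspace.submodule H₁)
    (Subspace.submodule H₂)
  have hle := Submodule.finrank_le (Subspace.submodule H₁ ⊔ Subspace.submodule H₂)
  have hlt : Module.finrank k (Subspace.submodule H₁) <
      Module.finrank k ↥(Subspace.submodule H₁ ⊔ Subspace.submodule H₂) := by
    refine Submodule.finrank_lt_finrank_of_lt (lt_of_le_of_ne le_sup_left fun h => hne ?_)
    exact (h₂.eq_of_le h₁ (h ▸ le_sup_right)).symm
  rw [IsLine, submodule_inf]
  simp at hle
  omega

variable {s : Finset (Projectivization.Subspace k (Fin 4 → k))}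
  {c : Projectivization.Subspace k (Fin 4 → k) → Module.Dual k (Fin 4 → k)}

theorem linearIndependent_pair_of_planes (hs : ∀ H ∈ s, IsPlane H)
    (hc : ∀ H ∈ s, LinearMap.ker (c H) = Subspace.submodule H)
    {H₁ H₂ : Projectivization.Subspace k (Fin 4 → k)} (h₁ : H₁ ∈ s) (h₂ : H₂ ∈ s)
    (hne : H₁ ≠ H₂) : LinearIndependent k ![c H₁, c H₂] := by
  -- Neither of two distinct planes contains the other; evaluating a linear relation at a point of
  -- each outside the other kills both coefficients.
  have key : ∀ H₁ ∈ s, ∀ H₂ ∈ s, H₁ ≠ H₂ → ∃ x, c H₁ x = 0 ∧ c H₂ x ≠ 0 := by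
    intro H₁ h₁ H₂ h₂ hne
    by_contra! h
    refine hne ((hs H₁ h₁).eq_of_le (hs H₂ h₂) fun x hx => ?_)
    rw [← hc _ h₁] at hx
    rw [← hc _ h₂]
    exact h x hx
  rw [LinearIndependent.pair_iff]
  intro a b hab
  obtain ⟨x, hx₁, hx₂⟩ := key _ h₁ _ h₂ hne
  obtain ⟨y, hy₂, hy₁⟩ := key _ h₂ _ h₁ hne.symm
  have hx := LinearMap.congr_fun hab x
  have hy := LinearMap.congr_fun hab y
  simp only [LinearMap.add_apply, LinearMap.smul_apply, hx₁, hy₂, smul_eq_mul, mul_zero, zero_add,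
    add_zero, LinearMap.zero_apply, mul_eq_zero, hx₂, hy₁, or_false] at hx hy
  exact ⟨hy, hx⟩

theorem exists_generic_parameters [Infinite k] (hs : ∀ H ∈ s, IsPlane H)
    (hc : ∀ H ∈ s, LinearMap.ker (c H) = Subspace.submodule H) :
    ∃ u v : Module.Dual k (Fin 4 → k), ∀ H₁ ∈ s, ∀ H₂ ∈ s, H₁ ≠ H₂ →
      LinearIndependent k ![c H₁, c H₂, u, v] := by
  classical
  let T := (s ×ˢ s).filter fun p => p.1 ≠ p.2
  have hT : ∀ p ∈ T, LinearIndependent k ![c p.1, c p.2] := by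
    intro p hp
    simp only [T, Finset.mem_filter, Finset.mem_product] at hp
    exact linearIndependent_pair_of_planes hs hc hp.1.1 hp.1.2 hp.2
  obtain ⟨u, hu⟩ := LinearIndependent.exists_generic_extension T (by simp) hT
  obtain ⟨v, hv⟩ := LinearIndependent.exists_generic_extension T (by simp) hu
  refine ⟨u, v, fun H₁ h₁ H₂ h₂ hne => ?_⟩
  have e : ![c H₁, c H₂, u, v] =
      (Fin.snoc (Fin.snoc ![c H₁, c H₂] u : Fin 3 → _) v : Fin 4 → Module.Dual k (Fin 4 → k)) := by
    ext i : 1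
    fin_cases i <;> rfl
  rw [e]
  exact hv (H₁, H₂) (by simp [T, h₁, h₂, hne])

theorem pairwisePrime_linForm [Infinite k] (hs : ∀ H ∈ s, IsPlane H)
    (hc : ∀ H ∈ s, LinearMap.ker (c H) = Subspace.submodule H)
    (hs₃ : ∀ H₁ ∈ s, ∀ H₂ ∈ s, ∀ H₃ ∈ s, H₁ ≠ H₂ → H₁ ≠ H₃ → H₂ ≠ H₃ →
      ¬ ∃ L, IsLine L ∧ L ≤ H₁ ∧ L ≤ H₂ ∧ L ≤ H₃) :
    PairwisePrime (fun H => linForm (c H)) s := by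
  obtain ⟨u, v, huv⟩ := exists_generic_parameters hs hc
  refine ⟨fun H₁ h₁ H₂ h₂ hne => (huv H₁ h₁ H₂ h₂ hne).isPrime_span_single,
    fun H₁ h₁ H₂ h₂ hne => (huv H₁ h₁ H₂ h₂ hne).notMem_span_single,
    fun H₁ h₁ H₂ h₂ hne => (huv H₁ h₁ H₂ h₂ hne).isPrime_span_pair,
    fun H₁ h₁ H₂ h₂ H₃ h₃ h₁₂ h₁₃ h₂₃ hmem => hs₃ H₁ h₁ H₂ h₂ H₃ h₃ h₁₂ h₁₃ h₂₃ ?_⟩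
  -- A form in the ideal of the line `H₁ ⊓ H₂` vanishes on it, so the third plane would contain that
  -- line.
  refine ⟨H₁ ⊓ H₂, (hs _ h₁).isLine_inf (hs _ h₂) h₁₂,
    fun P hP => (mem_inf_iff.1 hP).1, fun P hP => (mem_inf_iff.1 hP).2, ?_⟩
  rw [← Subspace.submodule.le_iff_le, submodule_inf, ← hc _ h₁, ← hc _ h₂, ← hc _ h₃]
  intro x hx
  rw [LinearMap.mem_ker, ← eval_linForm]
  exact eval_eq_zero_of_mem_span_pair hmem hx.1 hx.2

theorem homogeneousComponent_mem_span_pair {c₁ c₂ : Module.Dual k (Fin 4 → k)}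
    {f : MvPolynomial (Fin 4) k} (hf : f ∈ Ideal.span {linForm c₁, linForm c₂}) (n : ℕ) :
    homogeneousComponent n f ∈ Ideal.span {linForm c₁, linForm c₂} := by
  let _ := MvPolynomial.gradedAlgebra (σ := Fin 4) (R := k)
  refine homogeneousComponent_mem_of_mem (Ideal.homogeneous_span _ _ ?_) hf n
  rintro x (rfl | rfl) <;> exact ⟨1, isHomogeneous_linForm _⟩

theorem homogeneousIdealOf_eq_pairIdeal [Infinite k] (hs : ∀ H ∈ s, IsPlane H)
    (hc : ∀ H ∈ s, LinearMap.ker (c H) = Subspace.submodule H) :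
    homogeneousIdealOf (N := 3)
      (unionOf {L | ∃ H₁ ∈ s, ∃ H₂ ∈ s, H₁ ≠ H₂ ∧ L = H₁ ⊓ H₂}) =
      pairIdeal (fun H => linForm (c H)) s 1 := by
  obtain ⟨u, v, huv⟩ := exists_generic_parameters hs hc
  apply le_antisymm
  · refine Ideal.span_le.2 ?_
    rintro f ⟨⟨n, hn⟩, hf⟩
    rw [SetLike.mem_coe, mem_pairIdeal]
    intro H₁ h₁ H₂ h₂ hne
    rw [pow_one]
    refine (huv H₁ h₁ H₂ h₂ hne).mem_span_pair_of_eval_eq_zero fun x hx hx₁ hx₂ => ?_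
    rw [← hn.eval_rep_eq_zero_iff hx]
    refine hf _ ?_
    simp only [unionOf, Set.mem_iUnion]
    refine ⟨H₁ ⊓ H₂, ⟨H₁, h₁, H₂, h₂, hne, rfl⟩, ?_⟩
    rw [SetLike.mem_coe, ← Subspace.mem_submodule_iff _ hx, submodule_inf, ← hc _ h₁, ← hc _ h₂]
    exact ⟨hx₁, hx₂⟩
  · intro f hf
    -- Each ideal of a line is homogeneous, so the components of `f` vanish on the lines too.
    rw [← sum_homogeneousComponent f]
    refine Ideal.sum_mem _ fun n _ => Ideal.subset_span
      ⟨⟨n, homogeneousComponent_isHomogeneous n f⟩, fun P hP => ?_⟩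
    simp only [unionOf, Set.mem_iUnion] at hP
    obtain ⟨_, ⟨H₁, h₁, H₂, h₂, hne, rfl⟩, hP⟩ := hP
    have hmem := mem_pairIdeal.1 hf H₁ h₁ H₂ h₂ hne
    rw [pow_one] at hmem
    have hrep := rep_mem_submodule hP
    rw [submodule_inf, ← hc _ h₁, ← hc _ h₂] at hrep
    exact eval_eq_zero_of_mem_span_pair (homogeneousComponent_mem_span_pair hmem n) hrep.1 hrep.2

end Geometry

/-! ### Conclusion -/

theorem mainTheorem4 {k : Type*} [Field k] [IsAlgClosed k]
    (𝓛 : Set (Projectivization.Subspace k (Fin 4 → k))) (h𝓛 : IsPseudostar 𝓛) :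
    IsACM (N := 3) (homogeneousIdealOf (N := 3) (unionOf 𝓛)) ∧
      IsACM (N := 3) (symbolicPower (homogeneousIdealOf (N := 3) (unionOf 𝓛)) 2) := by
  classical
  obtain ⟨𝓗, hfin, hplane, hthree, rfl⟩ := h𝓛
  obtain ⟨s, rfl⟩ := hfin.exists_finset_coe
  simp only [Finset.mem_coe] at hplane hthree ⊢
  have hex : ∀ H : Projectivization.Subspace k (Fin 4 → k),
      ∃ c : Module.Dual k (Fin 4 → k), H ∈ s →
        LinearMap.ker c = Projectivization.Subspace.submodule H := fun H => by
    by_cases hH : H ∈ s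
    · obtain ⟨c, hc⟩ := (hplane H hH).exists_ker_eq
      exact ⟨c, fun _ => hc⟩
    -- An arbitrary value outside `s`, so that `c` is a total function.
    · exact ⟨0, fun h => absurd h hH⟩
  choose c hc using hex
  obtain ⟨u, v, huv⟩ := exists_generic_parameters hplane hc
  have hL := pairwisePrime_linForm hplane hc hthree
  have hP : ∀ H₁ ∈ s, ∀ H₂ ∈ s, H₁ ≠ H₂ → HasRegularParameters (linForm u) (linForm v)
      (Ideal.span {linForm (c H₁), linForm (c H₂)}) :=
    fun H₁ h₁ H₂ h₂ hne => (huv H₁ h₁ H₂ h₂ hne).hasRegularParameters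
  have hext := HasRegularParameters.extensionClosed (linForm u) (linForm v)
  have htop := HasRegularParameters.top (linForm u) (linForm v)
  rw [homogeneousIdealOf_eq_pairIdeal hplane hc, hL.symbolicPower_two]
  exact ⟨(hext.pairIdeal_one htop hL hP).isCohenMacaulay,
    (hext.pairIdeal_two htop hL hP).isCohenMacaulay⟩
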